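/- Let $n\ge 1$ be an integer, $\delta\in(0,n]$ and $p\in(\delta/n,\infty)$. For $d\in(0,n]$ and an arbitrary set $E\subset\mathbb{R}^n$ let $$\mathcal{H}^{d}_\infty(E)=\inf\Big\{\sum_{i} r_i^{d} : E\subset\bigcup_{i} B(x_i,r_i)\Big\}$$ be the $d$-dimensional Hausdorff content, where the infimum is taken over all countable (or finite) families of open Euclidean balls covering $E$. For an arbitrary set $\Omega\subset\mathbb{R}^n$ and an arbitrary function $g:\Omega\to[0,\infty]$ the Choquet integral is $$\int_\Omega g\,d\mathcal{H}^{d}_\infty=\int_0^\infty \mathcal{H}^{d}_\infty\big(\{x\in\Omega : g(x)>t\}\big)\,dt .$$ For an arbitrary function $f:\mathbb{R}^n\to[-\infty,\infty]$ the Hausdorff content centred maximal function is $$\mathcal{M}^n f(x)=\sup_{r>0}\frac{1}{\mathcal{H}^n_\infty(B(x,r))}\int_{B(x,r)}|f|\,d\mathcal{H}^n_\infty ,\qquad x\in\mathbb{R}^n .$$ Then there exists a finite constant $c$ depending only on $n$, $\delta$ and $p$ such that $$\int_{\mathbb{R}^n}\big(\mathcal{M}^n f(x)\big)^p\,d\mathcal{H}^\delta_\infty\le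 c\int_{\mathbb{R}^n}|f(x)|^p\,d\mathcal{H}^\delta_\infty$$ for all functions $f:\mathbb{R}^n\to[-\infty,\infty]$ (not necessarily Lebesgue measurable), where both sides may be infinite. -/

import Mathlib

open MeasureTheory
open scoped NNReal ENNReal

noncomputable section

/-- The `δ`-dimensional Hausdorff content of an arbitrary set `E ⊆ ℝⁿ`: the infimum of `∑ rᵢ ^ δ` over
all countable or finite covers of `E` by open balls `B(xᵢ, rᵢ)`. Covers are written as sequences;
the terms with `rᵢ = 0` are empty balls and contribute `0` (as `δ > 0`), so finite covers are
included. -/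
def hausdorffContent {n : ℕ} (δ : ℝ) (E : Set (EuclideanSpace ℝ (Fin n))) : ℝ≥0∞ :=
  ⨅ (x : ℕ → EuclideanSpace ℝ (Fin n)) (r : ℕ → ℝ≥0)
    (_ : E ⊆ ⋃ i, Metric.ball (x i) (r i : ℝ)), ∑' i, (r i : ℝ≥0∞) ^ δ

/-- The Choquet integral `∫_Ω f dH = ∫₀^∞ H({x ∈ Ω : f x > t}) dt` of a `[0, ∞]`-valued function with
respect to a set function `H`. For monotone `H` the integrand is decreasing in `t`, hence
measurable, so no measurability of `f` or `Ω` is needed. -/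
def choquetIntegral {X : Type*} (H : Set X → ℝ≥0∞) (Ω : Set X) (f : X → ℝ≥0∞) : ℝ≥0∞ :=
  ∫⁻ t in Set.Ioi (0 : ℝ), H {x | x ∈ Ω ∧ ENNReal.ofReal t < f x}

/-- The Hausdorff content centred maximal function
`𝓜^d f(x) = sup_{r > 0} H^d_∞(B(x,r))⁻¹ ∫_{B(x,r)} |f| dH^d_∞` of a function
`f : ℝⁿ → [-∞, ∞]`. -/
def contentMaximal {n : ℕ} (d : ℝ) (f : EuclideanSpace ℝ (Fin n) → EReal)
    (x : EuclideanSpace ℝ (Fin n)) : ℝ≥0∞ :=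
  ⨆ (r : ℝ) (_ : 0 < r),
    (hausdorffContent d (Metric.ball x r))⁻¹ *
      choquetIntegral (hausdorffContent d) (Metric.ball x r) (fun y => (f y).abs)

end

/-!
The content of a ball in the top dimension is `rⁿ` (`hausdorffContent_ball`), so the maximal function
is a supremum of averages with respect to `H = hausdorffContent n`. The theorem follows from a
restricted weak-type estimate at the critical exponent `δ / n`: the set of points that are centres of
a ball in which `E` has relative `H`-content larger than `τ ≤ 1` has `δ`-dimensional content at most a
multiple of `τ ^ (-δ / n)` times that of `E` (`hausdorffContent_contentDensitySet_le_rpow`). It is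
proved directly from a cover of `E` by balls: large covering balls absorb the points near them, and the
small ones are distributed over a Vitali family, where subadditivity of `s ↦ s ^ (δ / n)` turns the
`n`-dimensional density into a bound for the sum of the `δ`-th powers of the radii.

If `𝓜f(x) > lam`, then the layer-cake formula on a suitable ball shows that some level set
`{|f| > lam / 2 * 2 ^ j}`, `j ≥ 0`, has relative content at least `(1 - 2b) b ^ j` in that ball, where
`b < 1 / 2` is arbitrary (`setOf_lt_contentMaximal_subset`). The weak-type estimate therefore
bounds the content of `{𝓜f > 2 ^ m}` by a multiple of the sum over `j` of `b ^ (-j δ / n)` times the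
content of `{|f| > 2 ^ (m - 1 + j)}`. Multiplying by `2 ^ (p m)` and summing over all integers `m`
leaves the geometric series with ratio `b ^ (-δ / n) / 2 ^ p`, which converges for `b` close to
`1 / 2` precisely because `δ / n < p`. No additivity of the Choquet integral and no measurability is
used, only monotonicity and countable subadditivity of the contents.
-/

/-! ### Hausdorff content -/

section Content

variable {n : ℕ} {δ : ℝ}

theorem hausdorffContent_mono {A B : Set (EuclideanSpace ℝ (Fin n))} (h : A ⊆ B) :
    hausdorffContent δ A ≤ hausdorffContent δ B :=
  le_iInf fun x => le_iInf fun r => le_iInf fun hB =>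
    iInf_le_of_le x (iInf_le_of_le r (iInf_le_of_le (h.trans hB) le_rfl))

/-- Covers by families over an arbitrary countable index type also bound the content: missing
indices are filled with empty balls. -/
theorem hausdorffContent_le_tsum (hδ : 0 < δ) {ι : Type*} [Countable ι]
    {A : Set (EuclideanSpace ℝ (Fin n))} (x : ι → EuclideanSpace ℝ (Fin n)) (r : ι → ℝ≥0)
    (h : A ⊆ ⋃ i, Metric.ball (x i) (r i)) :
    hausdorffContent δ A ≤ ∑' i, (r i : ℝ≥0∞) ^ δ := by
  obtain ⟨e, he⟩ := exists_injective_nat ι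
  refine iInf_le_of_le (Function.extend e x 0)
    (iInf_le_of_le (Function.extend e r 0) (iInf_le_of_le ?_ ?_))
  · intro y hy
    obtain ⟨i, hi⟩ := Set.mem_iUnion.1 (h hy)
    refine Set.mem_iUnion.2 ⟨e i, ?_⟩
    rwa [he.extend_apply, he.extend_apply]
  · rw [← he.tsum_eq]
    · simp [he.extend_apply]
    · intro k hk
      by_contra hk'
      apply hk
      have h0 : Function.extend e r 0 k = 0 :=
        Function.extend_apply' r (0 : ℕ → ℝ≥0) k fun ⟨i, hi⟩ => hk' ⟨i, hi⟩
      simp [h0, hδ]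

theorem exists_cover_of_hausdorffContent_lt {A : Set (EuclideanSpace ℝ (Fin n))} {S : ℝ≥0∞}
    (h : hausdorffContent δ A < S) :
    ∃ (x : ℕ → EuclideanSpace ℝ (Fin n)) (r : ℕ → ℝ≥0),
      A ⊆ ⋃ i, Metric.ball (x i) (r i : ℝ) ∧ ∑' i, (r i : ℝ≥0∞) ^ δ < S := by
  simpa only [hausdorffContent, iInf_lt_iff, exists_prop] using h

theorem hausdorffContent_iUnion_le (hδ : 0 < δ) (A : ℕ → Set (EuclideanSpace ℝ (Fin n))) :
    hausdorffContent δ (⋃ i, A i) ≤ ∑' i, hausdorffContent δ (A i) := by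
  by_cases hfin : ∑' i, hausdorffContent δ (A i) = ∞
  · simp [hfin]
  refine ENNReal.le_of_forall_pos_le_add fun ε hε _ => ?_
  obtain ⟨ε', hε', hsum⟩ := ENNReal.exists_pos_sum_of_countable' (ENNReal.coe_pos.2 hε).ne' ℕ
  have hi : ∀ i, hausdorffContent δ (A i) < hausdorffContent δ (A i) + ε' i := fun i =>
    ENNReal.lt_add_right (ENNReal.ne_top_of_tsum_ne_top hfin i) (hε' i).ne'
  choose x r hx hr using fun i => exists_cover_of_hausdorffContent_lt (hi i)
  calc hausdorffContent δ (⋃ i, A i)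
      ≤ ∑' q : ℕ × ℕ, (r q.1 q.2 : ℝ≥0∞) ^ δ := by
        refine hausdorffContent_le_tsum hδ (fun q : ℕ × ℕ => x q.1 q.2) (fun q => r q.1 q.2) ?_
        refine Set.iUnion_subset fun i y hy => ?_
        obtain ⟨j, hj⟩ := Set.mem_iUnion.1 (hx i hy)
        exact Set.mem_iUnion.2 ⟨(i, j), hj⟩
    _ = ∑' i, ∑' j, (r i j : ℝ≥0∞) ^ δ :=
        ENNReal.tsum_prod (f := fun i j => (r i j : ℝ≥0∞) ^ δ)
    _ ≤ ∑' i, (hausdorffContent δ (A i) + ε' i) := ENNReal.tsum_le_tsum fun i => (hr i).le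
    _ ≤ ∑' i, hausdorffContent δ (A i) + ε := by
        rw [ENNReal.tsum_add]
        exact add_le_add le_rfl hsum.le

theorem hausdorffContent_ball_le (hδ : 0 < δ) (x : EuclideanSpace ℝ (Fin n)) (r : ℝ≥0) :
    hausdorffContent δ (Metric.ball x r) ≤ (r : ℝ≥0∞) ^ δ := by
  simpa using hausdorffContent_le_tsum hδ (fun _ : Unit => x) (fun _ => r)
    (Set.subset_iUnion (fun _ : Unit => Metric.ball x (r : ℝ)) ())

/-- In the top dimension the content of a ball is exactly `rⁿ`: the lower bound compares Lebesgue
measures, which is a multiple of `rⁿ` on every ball. -/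
theorem hausdorffContent_ball (hn : 1 ≤ n) (x : EuclideanSpace ℝ (Fin n)) (r : ℝ≥0) :
    hausdorffContent (n : ℝ) (Metric.ball x r) = (r : ℝ≥0∞) ^ (n : ℝ) := by
  have hn0 : (0 : ℝ) < n := by exact_mod_cast hn
  have : Nonempty (Fin n) := ⟨⟨0, hn⟩⟩
  refine le_antisymm (hausdorffContent_ball_le hn0 x r) ?_
  refine le_iInf fun y => le_iInf fun s => le_iInf fun hs => ?_
  set v := volume (Metric.ball (0 : EuclideanSpace ℝ (Fin n)) 1) with hv
  have hv0 : v ≠ 0 := (Metric.measure_ball_pos _ _ one_pos).ne'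
  have hvt : v ≠ ∞ := measure_ball_lt_top.ne
  have hvol : ∀ (z : EuclideanSpace ℝ (Fin n)) (t : ℝ≥0),
      volume (Metric.ball z (t : ℝ)) = (t : ℝ≥0∞) ^ (n : ℝ) * v := by
    intro z t
    rw [Measure.addHaar_ball _ _ t.coe_nonneg, ENNReal.ofReal_pow t.coe_nonneg, finrank_euclideanSpace_fin,
      ENNReal.ofReal_coe_nnreal, ENNReal.rpow_natCast]
  have h := (measure_mono hs).trans (measure_iUnion_le (μ := volume) _)
  simp only [hvol, ENNReal.tsum_mul_right] at h
  exact (ENNReal.mul_le_mul_iff_left hv0 hvt).1 h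

end Content

theorem ENNReal.rpow_tsum_le_tsum_rpow {ι : Type*} (f : ι → ℝ≥0∞) {q : ℝ} (hq : 0 < q)
    (hq1 : q ≤ 1) : (∑' i, f i) ^ q ≤ ∑' i, f i ^ q := by
  classical
  have hfin : ∀ s : Finset ι, (∑ i ∈ s, f i) ^ q ≤ ∑ i ∈ s, f i ^ q := by
    intro s
    induction s using Finset.induction_on with
    | empty => simp [hq]
    | insert a s ha ih =>
      rw [Finset.sum_insert ha, Finset.sum_insert ha]
      exact (ENNReal.rpow_add_le_add_rpow _ _ hq.le hq1).trans (by gcongr)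
  rw [← ENNReal.le_rpow_inv_iff hq, ENNReal.tsum_eq_iSup_sum]
  refine iSup_le fun s => ?_
  rw [ENNReal.le_rpow_inv_iff hq]
  exact (hfin s).trans (ENNReal.sum_le_tsum s)

/-! ### The restricted weak-type estimate -/

/-- The points that are centres of some ball in which `E` has relative `d`-dimensional content
larger than `τ`. For `d = n` these are the points where the content maximal function of the
indicator of `E` exceeds `τ`. -/
def contentDensitySet {n : ℕ} (d : ℝ) (τ : ℝ≥0∞) (E : Set (EuclideanSpace ℝ (Fin n))) :
    Set (EuclideanSpace ℝ (Fin n)) :=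
  {y | ∃ r : ℝ≥0, 0 < r ∧ τ * (r : ℝ≥0∞) ^ d < hausdorffContent d (Metric.ball y r ∩ E)}

section WeakType

variable {n : ℕ} {δ d : ℝ} {τ : ℝ≥0∞}

/-- Only the balls of the cover that meet `B(y, ρ)` matter for the content of `B(y, ρ) ∩ E`, and
since `δ / d ≤ 1` the passage from exponent `d` to exponent `δ` is subadditive. -/
theorem rpow_mul_rpow_le_tsum_of_dense (hδ : 0 < δ) (hδd : δ ≤ d)
    {E : Set (EuclideanSpace ℝ (Fin n))} {x : ℕ → EuclideanSpace ℝ (Fin n)} {r : ℕ → ℝ≥0}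
    (hE : E ⊆ ⋃ j, Metric.ball (x j) (r j : ℝ)) {y : EuclideanSpace ℝ (Fin n)} {ρ : ℝ≥0}
    (hρ : τ * (ρ : ℝ≥0∞) ^ d < hausdorffContent d (Metric.ball y ρ ∩ E)) :
    τ ^ (δ / d) * (ρ : ℝ≥0∞) ^ δ ≤
      ∑' j : {j | (Metric.ball (x j) (r j : ℝ) ∩ Metric.ball y ρ).Nonempty},
        (r j : ℝ≥0∞) ^ δ := by
  have hd : 0 < d := hδ.trans_le hδd
  have hq : 0 < δ / d := div_pos hδ hd
  have hdq : d * (δ / d) = δ := by field_simp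
  have hcov : hausdorffContent d (Metric.ball y ρ ∩ E) ≤
      ∑' j : {j | (Metric.ball (x j) (r j : ℝ) ∩ Metric.ball y ρ).Nonempty},
        (r j : ℝ≥0∞) ^ d := by
    refine hausdorffContent_le_tsum hd (fun j : {j | (Metric.ball (x j) (r j : ℝ) ∩
      Metric.ball y ρ).Nonempty} => x j) (fun j => r j) ?_
    rintro z ⟨hzy, hzE⟩
    obtain ⟨j, hj⟩ := Set.mem_iUnion.1 (hE hzE)
    exact Set.mem_iUnion.2 ⟨⟨j, z, hj, hzy⟩, hj⟩
  calc τ ^ (δ / d) * (ρ : ℝ≥0∞) ^ δ = (τ * (ρ : ℝ≥0∞) ^ d) ^ (δ / d) := by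
        rw [ENNReal.mul_rpow_of_nonneg _ _ hq.le, ← ENNReal.rpow_mul, hdq]
    _ ≤ (∑' j : {j | (Metric.ball (x j) (r j : ℝ) ∩ Metric.ball y ρ).Nonempty},
          (r j : ℝ≥0∞) ^ d) ^ (δ / d) := ENNReal.rpow_le_rpow (hρ.le.trans hcov) hq.le
    _ ≤ _ := by
        refine (ENNReal.rpow_tsum_le_tsum_rpow _ hq ((div_le_one hd).2 hδd)).trans_eq ?_
        simp only [← ENNReal.rpow_mul, hdq]

/-- Let `B(xⱼ, rⱼ)` cover `E`. A point of the density set whose ball `B(y, ρ)` meets a covering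
ball with `ρ ≤ rⱼ` lies in `B(xⱼ, 2rⱼ)`. For the remaining points a Vitali selection makes the
balls `B(y, 2ρ)` disjoint, so that every covering ball meets at most one selected `B(y, ρ)`. -/
theorem hausdorffContent_contentDensitySet_le_of_cover (hδ : 0 < δ) (hδd : δ ≤ d) (hτ : τ ≠ 0)
    (hτt : τ ≠ ∞) {E : Set (EuclideanSpace ℝ (Fin n))} {x : ℕ → EuclideanSpace ℝ (Fin n)}
    {r : ℕ → ℝ≥0} (hE : E ⊆ ⋃ j, Metric.ball (x j) (r j : ℝ))
    (hT : ∑' j, (r j : ℝ≥0∞) ^ δ ≠ ∞) :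
    hausdorffContent δ (contentDensitySet d τ E) ≤
      (2 ^ δ + 11 ^ δ * τ ^ (-(δ / d))) * ∑' j, (r j : ℝ≥0∞) ^ δ := by
  have hd : 0 < d := hδ.trans_le hδd
  set q := δ / d
  set T := ∑' j, (r j : ℝ≥0∞) ^ δ
  have hτq0 : τ ^ q ≠ 0 := by simp [hτ, hτt]
  have hτqt : τ ^ q ≠ ∞ := by simp [hτ, hτt]
  choose! ρ hρ0 hρ using fun y (hy : y ∈ contentDensitySet d τ E) => hy
  let J : EuclideanSpace ℝ (Fin n) → Set ℕ := fun y =>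
    {j | (Metric.ball (x j) (r j : ℝ) ∩ Metric.ball y (ρ y)).Nonempty}
  have hJ : ∀ y ∈ contentDensitySet d τ E,
      (ρ y : ℝ≥0∞) ^ δ ≤ τ ^ (-q) * ∑' j : J y, (r j : ℝ≥0∞) ^ δ := by
    intro y hy
    rw [ENNReal.rpow_neg, ← ENNReal.mul_le_iff_le_inv hτq0 hτqt]
    exact rpow_mul_rpow_le_tsum_of_dense hδ hδd hE (hρ y hy)
  let G : Set (EuclideanSpace ℝ (Fin n)) :=
    {y ∈ contentDensitySet d τ E | ∀ j ∈ J y, r j < ρ y}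
  -- The Vitali selection needs the radii to be bounded.
  have hM : τ ^ (-q) * T ≠ ∞ :=
    ENNReal.mul_ne_top (by simp [ENNReal.rpow_neg, hτq0]) hT
  have hR : ∀ y ∈ G, 2 * (ρ y : ℝ) ≤ 2 * ((τ ^ (-q) * T) ^ δ⁻¹).toReal := by
    intro y hy
    have h1 : (ρ y : ℝ≥0∞) ≤ (τ ^ (-q) * T) ^ δ⁻¹ := by
      rw [ENNReal.le_rpow_inv_iff hδ]
      refine (hJ y hy.1).trans ?_
      gcongr
      exact ENNReal.tsum_comp_le_tsum_of_injective Subtype.val_injective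
        fun j => (r j : ℝ≥0∞) ^ δ
    have h2 := ENNReal.toReal_mono (ENNReal.rpow_ne_top_of_nonneg (inv_nonneg.2 hδ.le) hM) h1
    rw [ENNReal.coe_toReal] at h2
    linarith
  obtain ⟨u, huG, hdisj, hcov⟩ :=
    Vitali.exists_disjoint_subfamily_covering_enlargement_closedBall G id
      (fun y => 2 * (ρ y : ℝ)) _ hR 5 (by norm_num)
  have hpos : ∀ y ∈ G, (0 : ℝ) < ρ y := fun y hy => NNReal.coe_pos.2 (hρ0 y hy.1)
  have hucount : u.Countable := by
    refine hdisj.countable_of_nonempty_interior fun y hy => ?_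
    refine ⟨y, Metric.ball_subset_interior_closedBall (Metric.mem_ball_self ?_)⟩
    have := hpos y (huG hy)
    positivity
  have : Countable u := hucount.to_subtype
  -- A covering ball meeting the selected ball around `y` has its centre within `2ρ` of `y`.
  have hcentre : ∀ y ∈ G, ∀ j ∈ J y, x j ∈ Metric.closedBall y (2 * (ρ y : ℝ)) := by
    rintro y hy j hj
    have hlt : (r j : ℝ) < ρ y := NNReal.coe_lt_coe.2 (hy.2 j hj)
    obtain ⟨z, hz1, hz2⟩ := hj
    rw [Metric.mem_ball] at hz1 hz2
    have := dist_triangle_left (x j) y z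
    exact Metric.mem_closedBall.2 (by linarith)
  have hinj : Function.Injective fun a : Σ b : u, J b => (a.2 : ℕ) := by
    rintro ⟨b, j, hj⟩ ⟨b', j', hj'⟩ (rfl : j = j')
    have hbb : b = b' := Subtype.ext <| hdisj.elim_set b.2 b'.2 (x j)
      (hcentre b (huG b.2) j hj) (hcentre b' (huG b'.2) j hj')
    subst hbb
    rfl
  have hsum : ∑' b : u, (ρ b : ℝ≥0∞) ^ δ ≤ τ ^ (-q) * T :=
    calc ∑' b : u, (ρ b : ℝ≥0∞) ^ δ
        ≤ ∑' b : u, τ ^ (-q) * ∑' j : J b, (r j : ℝ≥0∞) ^ δ :=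
          ENNReal.tsum_le_tsum fun b => hJ b (huG b.2).1
      _ = τ ^ (-q) * ∑' a : Σ b : u, J b, (r a.2 : ℝ≥0∞) ^ δ := by
          rw [ENNReal.tsum_mul_left, ENNReal.tsum_sigma']
      _ ≤ τ ^ (-q) * T := by
          gcongr
          exact ENNReal.tsum_comp_le_tsum_of_injective hinj fun j => (r j : ℝ≥0∞) ^ δ
  calc hausdorffContent δ (contentDensitySet d τ E)
      ≤ ∑' i : ℕ ⊕ u,
          ((Sum.elim (fun j => 2 * r j) (fun b : u => 11 * ρ b) i : ℝ≥0) : ℝ≥0∞) ^ δ := by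
        refine hausdorffContent_le_tsum hδ (Sum.elim x fun b : u => (b : EuclideanSpace ℝ (Fin n)))
          _ fun y hy => ?_
        by_cases hyG : y ∈ G
        · obtain ⟨b, hb, hsub⟩ := hcov y hyG
          have hyb := Metric.mem_closedBall.1
            (hsub (Metric.mem_closedBall_self (by positivity)))
          refine Set.mem_iUnion.2 ⟨Sum.inr ⟨b, hb⟩, ?_⟩
          have := hpos b (huG hb)
          simp only [Sum.elim_inr, Metric.mem_ball, NNReal.coe_mul, NNReal.coe_ofNat]
          simp only [id] at hyb
          linarith
        · have hex : ∃ j ∈ J y, ρ y ≤ r j := by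
            by_contra! h
            exact hyG ⟨hy, h⟩
          obtain ⟨j, ⟨z, hz1, hz2⟩, hj⟩ := hex
          have hj' : (ρ y : ℝ) ≤ r j := NNReal.coe_le_coe.2 hj
          refine Set.mem_iUnion.2 ⟨Sum.inl j, ?_⟩
          simp only [Sum.elim_inl, Metric.mem_ball, NNReal.coe_mul, NNReal.coe_ofNat]
          rw [Metric.mem_ball] at hz1 hz2
          have := dist_triangle_left y (x j) z
          linarith
    _ = 2 ^ δ * T + 11 ^ δ * ∑' b : u, (ρ b : ℝ≥0∞) ^ δ := by
        rw [Summable.tsum_sum ENNReal.summable ENNReal.summable]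
        simp only [Sum.elim_inl, Sum.elim_inr, ENNReal.coe_mul, ENNReal.coe_ofNat,
          ENNReal.mul_rpow_of_nonneg _ _ hδ.le, ENNReal.tsum_mul_left, T]
    _ ≤ 2 ^ δ * T + 11 ^ δ * (τ ^ (-q) * T) := by gcongr
    _ = (2 ^ δ + 11 ^ δ * τ ^ (-q)) * T := by ring

theorem hausdorffContent_contentDensitySet_le (hδ : 0 < δ) (hδd : δ ≤ d) (hτ : τ ≠ 0)
    (hτt : τ ≠ ∞) (E : Set (EuclideanSpace ℝ (Fin n))) :
    hausdorffContent δ (contentDensitySet d τ E) ≤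
      (2 ^ δ + 11 ^ δ * τ ^ (-(δ / d))) * hausdorffContent δ E := by
  have hK0 : 2 ^ δ + 11 ^ δ * τ ^ (-(δ / d)) ≠ 0 := by simp
  have hKt : 2 ^ δ + 11 ^ δ * τ ^ (-(δ / d)) ≠ ∞ := by
    have : τ ^ (-(δ / d)) ≠ ∞ := by simp [hτ, hτt]
    finiteness
  rw [mul_comm, ← ENNReal.div_le_iff hK0 hKt]
  refine le_of_forall_gt_imp_ge_of_dense fun S hS => ?_
  obtain ⟨x, r, hE, hT⟩ := exists_cover_of_hausdorffContent_lt hS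
  rw [ENNReal.div_le_iff hK0 hKt, mul_comm]
  exact (hausdorffContent_contentDensitySet_le_of_cover hδ hδd hτ hτt hE hT.ne_top).trans
    (by gcongr)

/-- The form used for summation: for `τ ≤ 1` the constant is a multiple of `τ ^ (-δ / d)`. -/
theorem hausdorffContent_contentDensitySet_le_rpow (hδ : 0 < δ) (hδd : δ ≤ d) (hτ : τ ≠ 0)
    (hτ1 : τ ≤ 1) (E : Set (EuclideanSpace ℝ (Fin n))) :
    hausdorffContent δ (contentDensitySet d τ E) ≤
      (2 ^ δ + 11 ^ δ) * τ ^ (-(δ / d)) * hausdorffContent δ E := by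
  refine (hausdorffContent_contentDensitySet_le hδ hδd hτ (hτ1.trans_lt (by simp)).ne E).trans ?_
  have h1 : 1 ≤ τ ^ (-(δ / d)) := by
    rw [ENNReal.rpow_neg, ENNReal.one_le_inv]
    exact ENNReal.rpow_le_one hτ1 (div_nonneg hδ.le (hδ.le.trans hδd))
  gcongr
  rw [add_mul]
  gcongr
  exact le_mul_of_one_le_right' h1

end WeakType

/-! ### Dyadic estimates for integrals of antitone functions -/

section Layers

variable {φ : ℝ → ℝ≥0∞} {β : ℝ}

theorem Antitone.setLIntegral_Ioc_le (hφ : Antitone φ) (a b : ℝ) :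
    ∫⁻ t in Set.Ioc a b, φ t ≤ ENNReal.ofReal (b - a) * φ a := by
  calc ∫⁻ t in Set.Ioc a b, φ t ≤ ∫⁻ _ in Set.Ioc a b, φ a :=
        setLIntegral_mono measurable_const fun t ht => hφ ht.1.le
    _ = ENNReal.ofReal (b - a) * φ a := by
        rw [setLIntegral_const, Real.volume_Ioc, mul_comm]

theorem Antitone.le_setLIntegral_Ioc (hφ : Antitone φ) (a b : ℝ) :
    ENNReal.ofReal (b - a) * φ b ≤ ∫⁻ t in Set.Ioc a b, φ t := by
  calc ENNReal.ofReal (b - a) * φ b = ∫⁻ _ in Set.Ioc a b, φ b := by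
        rw [setLIntegral_const, Real.volume_Ioc, mul_comm]
    _ ≤ ∫⁻ t in Set.Ioc a b, φ t :=
        setLIntegral_mono' measurableSet_Ioc fun t ht => hφ ht.2

theorem Antitone.lintegral_Ioi_le_tsum_zpow (hφ : Antitone φ) (hβ : 1 < β) :
    ∫⁻ t in Set.Ioi (0 : ℝ), φ t ≤
      ∑' k : ℤ, ENNReal.ofReal (β ^ (k + 1) - β ^ k) * φ (β ^ k) := by
  calc ∫⁻ t in Set.Ioi (0 : ℝ), φ t
      ≤ ∫⁻ t in ⋃ k : ℤ, Set.Ioc (β ^ k) (β ^ (k + 1)), φ t :=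
        lintegral_mono_set fun t ht => Set.mem_iUnion.2 (exists_mem_Ioc_zpow ht hβ)
    _ ≤ ∑' k : ℤ, ∫⁻ t in Set.Ioc (β ^ k) (β ^ (k + 1)), φ t := lintegral_iUnion_le _ _
    _ ≤ _ := ENNReal.tsum_le_tsum fun k => hφ.setLIntegral_Ioc_le _ _

theorem Antitone.tsum_zpow_le_lintegral_Ioi (hφ : Antitone φ) (hβ : 1 < β) :
    ∑' k : ℤ, ENNReal.ofReal (β ^ (k + 1) - β ^ k) * φ (β ^ (k + 1)) ≤
      ∫⁻ t in Set.Ioi (0 : ℝ), φ t := by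
  have hmono : Monotone fun k : ℤ => β ^ k := (zpow_right_strictMono₀ hβ).monotone
  calc ∑' k : ℤ, ENNReal.ofReal (β ^ (k + 1) - β ^ k) * φ (β ^ (k + 1))
      ≤ ∑' k : ℤ, ∫⁻ t in Set.Ioc (β ^ k) (β ^ (k + 1)), φ t :=
        ENNReal.tsum_le_tsum fun k => hφ.le_setLIntegral_Ioc _ _
    _ = ∫⁻ t in ⋃ k : ℤ, Set.Ioc (β ^ k) (β ^ (k + 1)), φ t :=
        (lintegral_iUnion (fun _ => measurableSet_Ioc) hmono.pairwise_disjoint_on_Ioc_succ _).symm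
    _ ≤ ∫⁻ t in Set.Ioi (0 : ℝ), φ t := by
        refine lintegral_mono_set (Set.iUnion_subset fun k t ht => ?_)
        exact (zpow_pos (zero_lt_one.trans hβ) k).trans ht.1

theorem Antitone.lintegral_Ioi_le_add_tsum_pow (hφ : Antitone φ) {s : ℝ} (hs : 0 < s) :
    ∫⁻ t in Set.Ioi (0 : ℝ), φ t ≤
      ENNReal.ofReal s * φ 0 + ∑' j : ℕ, ENNReal.ofReal (s * 2 ^ j) * φ (s * 2 ^ j) := by
  have hsub : Set.Ioi (0 : ℝ) ⊆
      Set.Ioc 0 s ∪ ⋃ j : ℕ, Set.Ioc (s * 2 ^ j) (s * 2 ^ (j + 1)) := by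
    intro t ht
    rcases le_or_gt t s with h | h
    · exact Or.inl ⟨ht, h⟩
    · obtain ⟨k, hk⟩ := exists_mem_Ioc_zpow (div_pos ht hs) (one_lt_two (α := ℝ))
      have h1 : (1 : ℝ) < 2 ^ (k + 1) := ((one_lt_div hs).2 h).trans_le hk.2
      have hk0 : 0 ≤ k := by
        have := (one_lt_zpow_iff_right₀ (one_lt_two (α := ℝ))).1 h1
        omega
      lift k to ℕ using hk0
      refine Or.inr (Set.mem_iUnion.2 ⟨k, ?_, ?_⟩)
      · have := (lt_div_iff₀' hs).1 hk.1
        exact_mod_cast this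
      · have := (div_le_iff₀' hs).1 hk.2
        exact_mod_cast this
  calc ∫⁻ t in Set.Ioi (0 : ℝ), φ t
      ≤ ∫⁻ t in Set.Ioc 0 s ∪ ⋃ j : ℕ, Set.Ioc (s * 2 ^ j) (s * 2 ^ (j + 1)), φ t :=
        lintegral_mono_set hsub
    _ ≤ (∫⁻ t in Set.Ioc 0 s, φ t) +
          ∑' j : ℕ, ∫⁻ t in Set.Ioc (s * 2 ^ j) (s * 2 ^ (j + 1)), φ t :=
        (lintegral_union_le _ _ _).trans (by gcongr; exact lintegral_iUnion_le _ _)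
    _ ≤ _ := by
        refine add_le_add ?_ (ENNReal.tsum_le_tsum fun j => ?_)
        · simpa using hφ.setLIntegral_Ioc_le 0 s
        · have h := hφ.setLIntegral_Ioc_le (s * 2 ^ j) (s * 2 ^ (j + 1))
          rwa [show s * 2 ^ (j + 1) - s * 2 ^ j = s * 2 ^ j by ring] at h

end Layers

/-! ### Superlevel sets of the maximal function -/

theorem choquetIntegrand_antitone {n : ℕ} (δ : ℝ) (Ω : Set (EuclideanSpace ℝ (Fin n)))
    (g : EuclideanSpace ℝ (Fin n) → ℝ≥0∞) :
    Antitone fun t : ℝ => hausdorffContent δ {x | x ∈ Ω ∧ ENNReal.ofReal t < g x} :=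
  fun _ _ hst => hausdorffContent_mono fun _ hx =>
    ⟨hx.1, (ENNReal.ofReal_le_ofReal hst).trans_lt hx.2⟩

/-- If the average of `|f|` over a ball exceeds `lam`, the part of the layer-cake integral below
`lam / 2` accounts for at most half of it, so one of the dyadic layers `{|f| > lam / 2 * 2 ^ j}` has
relative content above `(1 - 2 * b) * b ^ j` in that ball. These thresholds decay just slightly
faster than the layer heights `2 ^ j` grow. -/
theorem setOf_lt_contentMaximal_subset {n : ℕ} (hn : 1 ≤ n) {b : ℝ} (hb0 : 0 < b)
    (hb : 2 * b < 1) {lam : ℝ} (hlam : 0 < lam) (f : EuclideanSpace ℝ (Fin n) → EReal) :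
    {x | ENNReal.ofReal lam < contentMaximal (n : ℝ) f x} ⊆
      ⋃ j : ℕ, contentDensitySet (n : ℝ) (ENNReal.ofReal ((1 - 2 * b) * b ^ j))
        {y | ENNReal.ofReal (lam / 2 * 2 ^ j) < (f y).abs} := by
  intro x hx
  rw [Set.mem_ofPred_eq, contentMaximal] at hx
  obtain ⟨r, hx⟩ := lt_iSup_iff.1 hx
  obtain ⟨hr, hx⟩ := lt_iSup_iff.1 hx
  lift r to ℝ≥0 using hr.le
  rw [hausdorffContent_ball hn] at hx
  set V := (r : ℝ≥0∞) ^ (n : ℝ) with hV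
  have hr0 : (r : ℝ≥0∞) ≠ 0 := by simpa using hr.ne'
  have hV0 : V ≠ 0 := by simp [hV, hr0]
  have hVt : V ≠ ∞ := by simp [hV]
  rw [mul_comm, ← div_eq_mul_inv, ENNReal.lt_div_iff_mul_lt (Or.inl hV0) (Or.inl hVt)] at hx
  by_contra hcon
  have hsmall : ∀ j : ℕ, hausdorffContent (n : ℝ)
      (Metric.ball x r ∩ {y | ENNReal.ofReal (lam / 2 * 2 ^ j) < (f y).abs}) ≤
        ENNReal.ofReal ((1 - 2 * b) * b ^ j) * V := by
    intro j
    by_contra! h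
    exact hcon (Set.mem_iUnion.2 ⟨j, r, NNReal.coe_pos.1 hr, h⟩)
  have hgeom : HasSum (fun j : ℕ => lam / 2 * 2 ^ j * ((1 - 2 * b) * b ^ j)) (lam / 2) := by
    have h := (hasSum_geometric_of_lt_one (by positivity) hb).mul_left (lam / 2 * (1 - 2 * b))
    have hb' : 1 - 2 * b ≠ 0 := by linarith
    convert! h using 1
    · ext j
      rw [mul_pow]
      ring
    · field_simp
  have hgeom' : ∑' j : ℕ, ENNReal.ofReal (lam / 2 * 2 ^ j * ((1 - 2 * b) * b ^ j)) =
      ENNReal.ofReal (lam / 2) := by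
    rw [← ENNReal.ofReal_tsum_of_nonneg _ hgeom.summable, hgeom.tsum_eq]
    intro j
    have : 0 < 1 - 2 * b := by linarith
    positivity
  refine absurd hx (not_lt.2 ?_)
  calc choquetIntegral (hausdorffContent (n : ℝ)) (Metric.ball x r) (fun y => (f y).abs)
      ≤ ENNReal.ofReal (lam / 2) * V + ∑' j : ℕ, ENNReal.ofReal (lam / 2 * 2 ^ j) *
          (ENNReal.ofReal ((1 - 2 * b) * b ^ j) * V) := by
        refine ((choquetIntegrand_antitone _ _ _).lintegral_Ioi_le_add_tsum_pow
          (half_pos hlam)).trans ?_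
        refine add_le_add (mul_le_mul_right ?_ _)
          (ENNReal.tsum_le_tsum fun j => mul_le_mul_right (hsmall j) _)
        rw [hV, ← hausdorffContent_ball hn x r]
        exact hausdorffContent_mono fun y hy => hy.1
    _ = ENNReal.ofReal (lam / 2) * V + (∑' j : ℕ,
          ENNReal.ofReal (lam / 2 * 2 ^ j * ((1 - 2 * b) * b ^ j))) * V := by
        rw [← ENNReal.tsum_mul_right]
        congr 2
        ext j
        rw [← mul_assoc, ← ENNReal.ofReal_mul (by positivity)]
    _ = ENNReal.ofReal lam * V := by
        rw [hgeom', ← add_mul, ← ENNReal.ofReal_add (by positivity) (by positivity), add_halves]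

/-- The superlevel set estimate at height `2 ^ m`, in which only the levels of `|f|` above
`2 ^ (m - 1)` appear. -/
theorem hausdorffContent_lt_contentMaximal_le {n : ℕ} (hn : 1 ≤ n) {δ : ℝ} (hδ : 0 < δ)
    (hδn : δ ≤ n) {b : ℝ} (hb0 : 0 < b) (hb : 2 * b < 1) (m : ℤ)
    (f : EuclideanSpace ℝ (Fin n) → EReal) :
    hausdorffContent δ {x | ENNReal.ofReal (2 ^ m) < contentMaximal (n : ℝ) f x} ≤
      ∑' j : ℕ, (2 ^ δ + 11 ^ δ) * ENNReal.ofReal (((1 - 2 * b) * b ^ j) ^ (-(δ / n))) *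
        hausdorffContent δ {y | ENNReal.ofReal (2 ^ (m - 1 + j)) < (f y).abs} := by
  refine (hausdorffContent_mono (setOf_lt_contentMaximal_subset hn hb0 hb
    (zpow_pos two_pos m) f)).trans ((hausdorffContent_iUnion_le hδ _).trans
      (ENNReal.tsum_le_tsum fun j => ?_))
  have hpos : 0 < (1 - 2 * b) * b ^ j := mul_pos (by linarith) (by positivity)
  have hle : (1 - 2 * b) * b ^ j ≤ 1 :=
    mul_le_one₀ (by linarith) (by positivity) (pow_le_one₀ hb0.le (by linarith))
  have hlevel : (2 : ℝ) ^ m / 2 * 2 ^ j = 2 ^ (m - 1 + j) := by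
    rw [zpow_add₀ two_ne_zero, zpow_sub_one₀ two_ne_zero, zpow_natCast, div_eq_mul_inv]
  rw [hlevel, ← ENNReal.ofReal_rpow_of_pos hpos]
  exact hausdorffContent_contentDensitySet_le_rpow hδ hδn (by simpa using hpos)
    (by simpa using hle) _

/-! ### Summation over dyadic levels -/

theorem ofReal_zpow_lt_rpow_iff {p : ℝ} (hp : 0 < p) (k : ℤ) (y : ℝ≥0∞) :
    ENNReal.ofReal (((2 : ℝ) ^ p) ^ k) < y ^ p ↔ ENNReal.ofReal (2 ^ k) < y := by
  have h : ((2 : ℝ) ^ p) ^ k = ((2 : ℝ) ^ k) ^ p := by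
    rw [← Real.rpow_intCast, ← Real.rpow_intCast, ← Real.rpow_mul two_pos.le,
      ← Real.rpow_mul two_pos.le, mul_comm]
  rw [h, ← ENNReal.ofReal_rpow_of_pos (zpow_pos two_pos k), ENNReal.rpow_lt_rpow_iff hp]

theorem choquetIntegral_rpow_le_tsum {n : ℕ} (δ : ℝ) {p : ℝ} (hp : 0 < p)
    (g : EuclideanSpace ℝ (Fin n) → ℝ≥0∞) :
    choquetIntegral (hausdorffContent δ) Set.univ (fun x => g x ^ p) ≤
      ∑' k : ℤ, ENNReal.ofReal (((2 : ℝ) ^ p) ^ (k + 1)) *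
        hausdorffContent δ {x | ENNReal.ofReal (2 ^ k) < g x} := by
  have hβ : 1 < (2 : ℝ) ^ p := Real.one_lt_rpow one_lt_two hp
  refine ((choquetIntegrand_antitone δ Set.univ fun x => g x ^ p).lintegral_Ioi_le_tsum_zpow
    hβ).trans (ENNReal.tsum_le_tsum fun k => ?_)
  simp only [ofReal_zpow_lt_rpow_iff hp, Set.mem_univ, true_and]
  gcongr
  have : 0 < ((2 : ℝ) ^ p) ^ k := by positivity
  linarith

theorem tsum_le_choquetIntegral_rpow {n : ℕ} (δ : ℝ) {p : ℝ} (hp : 0 < p)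
    (g : EuclideanSpace ℝ (Fin n) → ℝ≥0∞) :
    ∑' k : ℤ, ENNReal.ofReal (((2 : ℝ) ^ p) ^ k) *
        hausdorffContent δ {x | ENNReal.ofReal (2 ^ k) < g x} ≤
      ENNReal.ofReal (2 ^ p / (2 ^ p - 1)) *
        choquetIntegral (hausdorffContent δ) Set.univ (fun x => g x ^ p) := by
  have hβ : 1 < (2 : ℝ) ^ p := Real.one_lt_rpow one_lt_two hp
  have hβ1 : 0 < (2 : ℝ) ^ p - 1 := by linarith
  have h := (choquetIntegrand_antitone δ Set.univ fun x => g x ^ p).tsum_zpow_le_lintegral_Ioi hβ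
  simp only [ofReal_zpow_lt_rpow_iff hp, Set.mem_univ, true_and] at h
  simp only [choquetIntegral, Set.mem_univ, true_and]
  rw [← (Equiv.addRight (1 : ℤ)).tsum_eq]
  refine le_trans (le_of_eq ?_) (mul_le_mul_right h _)
  rw [← ENNReal.tsum_mul_left]
  congr 1
  ext k
  rw [Equiv.coe_addRight, ← mul_assoc, ← ENNReal.ofReal_mul (by positivity),
    zpow_add_one₀ (by positivity)]
  congr 2
  field_simp

/-- The hypothesis `q < p` leaves room for a ratio `b` slightly below `1 / 2`. -/
theorem exists_ratio_lt_half {p q : ℝ} (hq : 0 < q) (hqp : q < p) :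
    ∃ b : ℝ, 0 < b ∧ 2 * b < 1 ∧ b ^ (-q) < (2 : ℝ) ^ p := by
  refine ⟨2 ^ (-((p + q) / (2 * q))), by positivity, ?_, ?_⟩
  · have h1 : 1 < (p + q) / (2 * q) := by
      rw [one_lt_div (by positivity)]
      linarith
    calc (2 : ℝ) * 2 ^ (-((p + q) / (2 * q))) < 2 * 2 ^ (-1 : ℝ) := by
          have := Real.rpow_lt_rpow_of_exponent_lt one_lt_two (neg_lt_neg h1)
          linarith
      _ = 1 := by
          rw [Real.rpow_neg_one]
          norm_num
  · rw [← Real.rpow_mul two_pos.le]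
    apply Real.rpow_lt_rpow_of_exponent_lt one_lt_two
    have : -((p + q) / (2 * q)) * -q = (p + q) / 2 := by field_simp
    linarith

theorem mainTheorem1 (n : ℕ) (hn : 1 ≤ n) (δ : ℝ) (hδ : 0 < δ) (hδn : δ ≤ (n : ℝ))
    (p : ℝ) (hp : δ / (n : ℝ) < p) :
    ∃ c : ℝ≥0, ∀ f : EuclideanSpace ℝ (Fin n) → EReal,
      choquetIntegral (hausdorffContent δ) Set.univ
          (fun x => contentMaximal (n : ℝ) f x ^ p) ≤
        (c : ℝ≥0∞) * choquetIntegral (hausdorffContent δ) Set.univ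
          (fun x => (f x).abs ^ p) := by
  have hq : 0 < δ / n := div_pos hδ (hδ.trans_le hδn)
  have hp0 : 0 < p := hq.trans hp
  obtain ⟨b, hb0, hb, hbp⟩ := exists_ratio_lt_half hq hp
  have hb1 : 0 < 1 - 2 * b := by linarith
  set q := δ / (n : ℝ)
  set β : ℝ := 2 ^ p
  have hβ0 : 0 < β := by positivity
  -- `w j` collects everything that depends on the distance `j` between the level of the maximal
  -- function and the level of `|f|`.
  let w : ℕ → ℝ := fun j => ((1 - 2 * b) * b ^ j) ^ (-q) * β ^ (2 - j : ℤ)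
  have hw0 : ∀ j, 0 ≤ w j := fun j => by positivity
  have hw : Summable w := by
    have h : Summable fun j : ℕ => (1 - 2 * b) ^ (-q) * β ^ 2 * (b ^ (-q) / β) ^ j :=
      (summable_geometric_of_lt_one (by positivity) ((div_lt_one hβ0).2 hbp)).mul_left _
    refine h.congr fun j => ?_
    change _ = ((1 - 2 * b) * b ^ j) ^ (-q) * β ^ (2 - j : ℤ)
    rw [Real.mul_rpow hb1.le (by positivity), ← Real.rpow_pow_comm hb0.le, div_pow,
      zpow_sub₀ hβ0.ne', zpow_natCast]
    norm_cast
    ring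
  let K : ℝ≥0∞ := ((2 ^ δ + 11 ^ δ) * ∑' j, ENNReal.ofReal (w j)) *
    ENNReal.ofReal (β / (β - 1))
  have hK : K ≠ ∞ := by
    have : ∑' j, ENNReal.ofReal (w j) ≠ ∞ := by
      rw [← ENNReal.ofReal_tsum_of_nonneg hw0 hw]
      exact ENNReal.ofReal_ne_top
    finiteness
  refine ⟨K.toNNReal, fun f => ?_⟩
  rw [ENNReal.coe_toNNReal hK]
  set h : ℤ → ℝ≥0∞ := fun k => hausdorffContent δ {y | ENNReal.ofReal (2 ^ k) < (f y).abs}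
  calc choquetIntegral (hausdorffContent δ) Set.univ (fun x => contentMaximal (n : ℝ) f x ^ p)
      ≤ ∑' m : ℤ, ENNReal.ofReal (β ^ (m + 1)) *
          hausdorffContent δ {x | ENNReal.ofReal (2 ^ m) < contentMaximal (n : ℝ) f x} :=
        choquetIntegral_rpow_le_tsum δ hp0 _
    _ ≤ ∑' m : ℤ, ENNReal.ofReal (β ^ (m + 1)) * ∑' j : ℕ, (2 ^ δ + 11 ^ δ) *
          ENNReal.ofReal (((1 - 2 * b) * b ^ j) ^ (-q)) * h (m - 1 + j) :=
        ENNReal.tsum_le_tsum fun m => mul_le_mul_right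
          (hausdorffContent_lt_contentMaximal_le hn hδ hδn hb0 hb m f) _
    _ = ∑' j : ℕ, ∑' m : ℤ, (2 ^ δ + 11 ^ δ) * ENNReal.ofReal (w j) *
          (ENNReal.ofReal (β ^ (m - 1 + j)) * h (m - 1 + j)) := by
        rw [ENNReal.tsum_comm]
        refine tsum_congr fun m => ?_
        rw [← ENNReal.tsum_mul_left]
        refine tsum_congr fun j => ?_
        have hsplit : β ^ (m + 1) = β ^ (2 - j : ℤ) * β ^ (m - 1 + j) := by
          rw [← zpow_add₀ hβ0.ne']
          congr 1
          ring
        rw [hsplit, ENNReal.ofReal_mul (by positivity), ENNReal.ofReal_mul (by positivity)]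
        ring
    _ = ∑' j : ℕ, (2 ^ δ + 11 ^ δ) * ENNReal.ofReal (w j) *
          ∑' k : ℤ, ENNReal.ofReal (β ^ k) * h k := by
        refine tsum_congr fun j => ?_
        rw [ENNReal.tsum_mul_left]
        congr 1
        rw [← (Equiv.addRight (-1 + j : ℤ)).tsum_eq fun k : ℤ => ENNReal.ofReal (β ^ k) * h k]
        refine tsum_congr fun m => ?_
        simp only [Equiv.coe_addRight, ← add_assoc, ← sub_eq_add_neg]
    _ = ((2 ^ δ + 11 ^ δ) * ∑' j, ENNReal.ofReal (w j)) *
          ∑' k : ℤ, ENNReal.ofReal (β ^ k) * h k := by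
        rw [ENNReal.tsum_mul_right, ENNReal.tsum_mul_left]
    _ ≤ ((2 ^ δ + 11 ^ δ) * ∑' j, ENNReal.ofReal (w j)) * (ENNReal.ofReal (β / (β - 1)) *
          choquetIntegral (hausdorffContent δ) Set.univ (fun x => (f x).abs ^ p)) :=
        mul_le_mul_right (tsum_le_choquetIntegral_rpow δ hp0 fun x => (f x).abs) _
    _ = K * choquetIntegral (hausdorffContent δ) Set.univ (fun x => (f x).abs ^ p) := by
        rw [← mul_assoc]
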